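/- Let $C=\left\{\sum_{j=1}^{\infty} a_j 3^{-j} : a_j\in\{0,2\}\text{ for all } j\ge 1\right\}$ be the middle-third Cantor set, and for each integer $n\ge 1$ let $$a_n=\prod_{k=1}^{n}(k^2+1).$$ Then $$\left\{\frac{1}{a_n} : n\ge 1\right\}\cap C=\left\{\frac{1}{10}\right\};$$ equivalently, for every integer $n\ge 1$, one has $\frac{1}{a_n}\in C$ if and only if $n=2$. -/

import Mathlib

/-- The missing-digit set `K_{m,D}`: all reals `∑_{j ≥ 1} a_j / m^j` whose base-`m` digits `a_j`
all lie in `D ⊆ {0, 1, …, m - 1}`.  The digit `a_j` is stored as `a (j - 1)`. -/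
def missingDigitSet (m : ℕ) (D : Set (Fin m)) : Set ℝ :=
  {x : ℝ | ∃ a : ℕ → Fin m, (∀ j, a j ∈ D) ∧ x = ∑' j : ℕ, ((a j : ℕ) : ℝ) / (m : ℝ) ^ (j + 1)}

/-- For base `3` and digits `{0, 2}` this is Mathlib's ternary Cantor set. -/
theorem missingDigitSet_three_eq_cantorSet :
    missingDigitSet 3 {0, 2} = cantorSet := by
  have key : ∀ a : ℕ → Fin 3,
      Real.ofDigits a = ∑' j : ℕ, ((a j : ℕ) : ℝ) / ((3 : ℕ) : ℝ) ^ (j + 1) := by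
    intro a
    simp only [Real.ofDigits, Real.ofDigitsTerm, div_eq_mul_inv]
  ext x
  constructor
  · rintro ⟨a, ha, rfl⟩
    rw [← key]
    refine ofDigits_zero_two_sequence_mem_cantorSet fun n => ?_
    rcases ha n with h | h <;> rw [h] <;> decide
  · intro hx
    refine ⟨(cantorToTernary x).get, fun j => ?_, ?_⟩
    · have := cantorToTernary_ne_one (x := x) (n := j)
      generalize (cantorToTernary x).get j = d at *
      fin_cases d <;> simp_all
    · rw [← key]
      exact (ofDigits_cantorToTernary hx).symm

/-- The product `a_n = ∏_{k=1}^n (k² + 1)`. -/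
def polyProd (n : ℕ) : ℕ := ∏ k ∈ Finset.Icc 1 n, (k ^ 2 + 1)

/-! The set `C` is stable under tripling modulo 1 and misses the open middle third, so `1 / a ∉ C`
once some `3 ^ m` modulo `a` lies strictly between `a / 3` and `2 * a / 3`. For large `n`, some `3 ^
m` is `1 + a / 2` modulo `a`. Write `a_n = 2 ^ e * M` with `M` odd and `e = (n + 1) / 2`. Primes
dividing `M` are at most `n ^ 2 + 1`, far below `2 ^ e`, so an exponent `m` with 2-adic valuation
only `e - 3` gives `3 ^ m ≡ 1` modulo `M`; lifting the exponent then gives `3 ^ m - 1` valuation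
exactly `e - 1`, one short of `e`. Small `n` are computed. -/

/-- The ternary Cantor set contains no point of the open middle third. -/
theorem not_mem_cantorSet_of_middle_third {x : ℝ} (h₁ : 1 / 3 < x) (h₂ : x < 2 / 3) :
    x ∉ cantorSet := by
  intro hx
  rw [cantorSet_eq_union_halves] at hx
  rcases hx with ⟨y, hy, rfl⟩ | ⟨y, hy, rfl⟩
  · have := (cantorSet_subset_unitInterval hy).2
    dsimp only at h₁
    linarith
  · have := (cantorSet_subset_unitInterval hy).1
    dsimp only at h₂
    linarith

/-- The Cantor set is invariant under multiplication by powers of `3` modulo `1`. -/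
theorem exists_int_pow_mul_sub_mem_cantorSet {x : ℝ} (hx : x ∈ cantorSet) (m : ℕ) :
    ∃ z : ℤ, 3 ^ m * x - z ∈ cantorSet := by
  induction m with
  | zero => exact ⟨0, by simpa using hx⟩
  | succ m ih =>
    obtain ⟨z, hz⟩ := ih
    rw [cantorSet_eq_union_halves] at hz
    rcases hz with ⟨y, hy, h⟩ | ⟨y, hy, h⟩ <;> dsimp only at h
    · refine ⟨3 * z, ?_⟩
      convert hy using 1
      push_cast
      rw [pow_succ]
      linarith
    · refine ⟨3 * z + 2, ?_⟩
      convert hy using 1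
      push_cast
      rw [pow_succ]
      linarith

/-- If some power of `3` has its residue modulo `a` in the open middle third of `(0, a)`, then
`1 / a` is not in the Cantor set. -/
theorem one_div_not_mem_cantorSet {a m r t : ℕ} (h : 3 ^ m = r + a * t)
    (h₁ : a < 3 * r) (h₂ : 3 * r < 2 * a) : (1 / a : ℝ) ∉ cantorSet := by
  intro hx
  obtain ⟨z, hz⟩ := exists_int_pow_mul_sub_mem_cantorSet hx m
  have ha : (0 : ℝ) < a := by
    have : 0 < a := by omega
    exact_mod_cast this
  have hr₁ : (1 / 3 : ℝ) < r / a := by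
    rw [lt_div_iff₀ ha]
    have : (a : ℝ) < 3 * r := by exact_mod_cast h₁
    linarith
  have hr₂ : (r / a : ℝ) < 2 / 3 := by
    rw [div_lt_iff₀ ha]
    have : (3 * r : ℝ) < 2 * a := by exact_mod_cast h₂
    linarith
  have heq : (3 : ℝ) ^ m * (1 / a) - z = r / a + ((t - z : ℤ) : ℝ) := by
    have : (3 : ℝ) ^ m = r + a * t := by exact_mod_cast h
    rw [this]
    push_cast
    field_simp
    ring
  rw [heq] at hz
  have hI := cantorSet_subset_unitInterval hz
  -- Both `r / a` and its integer translate lie in `[0, 1]`, the former strictly inside, so the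
  -- shift vanishes.
  have hlo : (-1 : ℤ) < t - z := by
    have : ((-1 : ℤ) : ℝ) < ((t - z : ℤ) : ℝ) := by
      push_cast [-Int.cast_sub]
      linarith [hI.1]
    exact_mod_cast this
  have hhi : (t - z : ℤ) < 1 := by
    have : ((t - z : ℤ) : ℝ) < ((1 : ℤ) : ℝ) := by
      push_cast [-Int.cast_sub]
      linarith [hI.2]
    exact_mod_cast this
  have h0 : (t - z : ℤ) = 0 := by omega
  rw [h0, Int.cast_zero, add_zero] at hz
  exact not_mem_cantorSet_of_middle_third hr₁ hr₂ hz

/-- Tripling modulo 1 cycles 1/10, 3/10, 9/10, 7/10, never meeting the middle third; the induction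
carries the whole orbit. -/
theorem one_tenth_mem_cantorSet : (1 / 10 : ℝ) ∈ cantorSet := by
  have key : ∀ n, (1 / 10 : ℝ) ∈ preCantorSet n ∧ (3 / 10 : ℝ) ∈ preCantorSet n ∧
      (9 / 10 : ℝ) ∈ preCantorSet n ∧ (7 / 10 : ℝ) ∈ preCantorSet n := by
    intro n
    induction n with
    | zero => simp only [preCantorSet_zero, Set.mem_Icc]; norm_num
    | succ n ih =>
      obtain ⟨h₁, h₃, h₉, h₇⟩ := ih
      rw [preCantorSet_succ]
      exact ⟨Or.inl ⟨_, h₃, by norm_num⟩, Or.inl ⟨_, h₉, by norm_num⟩,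
        Or.inr ⟨_, h₇, by norm_num⟩, Or.inr ⟨_, h₁, by norm_num⟩⟩
  exact Set.mem_iInter.2 fun n => (key n).1

theorem polyProd_succ (n : ℕ) : polyProd (n + 1) = polyProd n * ((n + 1) ^ 2 + 1) :=
  Finset.prod_Icc_succ_top (by omega) _

theorem exists_dvd_sq_add_one_of_dvd_polyProd {p n : ℕ} (hp : p.Prime) (h : p ∣ polyProd n) :
    ∃ k ≤ n, p ∣ k ^ 2 + 1 := by
  obtain ⟨k, hk, hd⟩ := (hp.prime.dvd_finsetProd_iff _).1 h
  exact ⟨k, (Finset.mem_Icc.1 hk).2, hd⟩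

theorem le_of_prime_dvd_polyProd {p n : ℕ} (hp : p.Prime) (h : p ∣ polyProd n) :
    p ≤ n ^ 2 + 1 := by
  obtain ⟨k, hk, hd⟩ := exists_dvd_sq_add_one_of_dvd_polyProd hp h
  exact (Nat.le_of_dvd (by positivity) hd).trans (by gcongr)

/-- -1 is not a square modulo 3. -/
theorem three_not_dvd_polyProd (n : ℕ) : ¬ 3 ∣ polyProd n := by
  intro h
  obtain ⟨k, -, hd⟩ := exists_dvd_sq_add_one_of_dvd_polyProd Nat.prime_three h
  have hk : k % 3 = 0 ∨ k % 3 = 1 ∨ k % 3 = 2 := by omega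
  have := Nat.mod_eq_zero_of_dvd hd
  rcases hk with hk | hk | hk <;> simp [Nat.add_mod, Nat.pow_mod, hk] at this

/-- The exact power of `2` dividing `polyProd n` is `2 ^ ((n + 1) / 2)`. -/
theorem exists_odd_polyProd_eq (n : ℕ) :
    ∃ M, Odd M ∧ polyProd n = 2 ^ ((n + 1) / 2) * M := by
  induction n with
  | zero => exact ⟨1, odd_one, by simp [polyProd]⟩
  | succ n ih =>
    obtain ⟨M, hM, h⟩ := ih
    rcases Nat.even_or_odd' n with ⟨j, rfl | rfl⟩
    -- The new factor `k ^ 2 + 1` is 2 modulo 4 for odd `k` and odd for even `k`.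
    · refine ⟨M * (2 * (j ^ 2 + j) + 1), hM.mul ⟨_, rfl⟩, ?_⟩
      rw [polyProd_succ, h, show (2 * j + 1) / 2 = j by omega,
        show (2 * j + 1 + 1) / 2 = j + 1 by omega]
      ring
    · refine ⟨M * (2 * (2 * (j + 1) ^ 2) + 1), hM.mul ⟨_, rfl⟩, ?_⟩
      rw [polyProd_succ, h, show (2 * j + 1 + 1) / 2 = j + 1 by omega,
        show (2 * j + 1 + 1 + 1) / 2 = j + 1 by omega]
      ring

/-- If `2 ^ (s + 1)` exceeds `p - 1` for every prime `p` dividing the odd number `M`, then the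
order of `b`, coprime to `M`, modulo `M` divides `2 ^ s` times the odd part of `φ M`. -/
theorem dvd_pow_sub_one_of_prime_le {M s b : ℕ} (hM : Odd M) (hb : b.Coprime M)
    (hs : ∀ p, p.Prime → p ∣ M → p ≤ 2 ^ (s + 1)) :
    M ∣ b ^ (2 ^ s * ordCompl[2] M.totient) - 1 := by
  rw [Nat.dvd_iff_prime_pow_dvd_dvd]
  intro p k hp hpk
  rcases Nat.eq_zero_or_pos k with rfl | hk
  · simp
  have hpM : p ∣ M := (dvd_pow_self p hk.ne').trans hpk
  have hpodd : Odd p := hM.of_dvd_nat hpM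
  have hdvd : (p ^ k).totient ∣ 2 ^ s * ordCompl[2] M.totient := by
    rw [← Nat.ordProj_mul_ordCompl_eq_self (p ^ k).totient 2]
    refine mul_dvd_mul (pow_dvd_pow 2 ?_)
      (Nat.ordCompl_dvd_ordCompl_of_dvd (Nat.totient_dvd_of_dvd hpk) 2)
    -- In `φ (p ^ k) = p ^ (k - 1) * (p - 1)` the first factor is odd.
    have h₁ : 2 ^ (p ^ k).totient.factorization 2 ∣ p - 1 := by
      have h₂ := Nat.ordProj_dvd (p ^ k).totient 2
      nth_rewrite 2 [Nat.totient_prime_pow hp hk] at h₂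
      exact (Nat.Coprime.pow _ _ (Nat.coprime_two_left.2 hpodd)).dvd_of_dvd_mul_left h₂
    have h₃ := Nat.le_of_dvd (by have := hp.two_le; omega) h₁
    have h₄ := hs p hp hpM
    have h₅ : 2 ^ (p ^ k).totient.factorization 2 < 2 ^ (s + 1) := by
      have := hp.two_le
      omega
    have := (Nat.pow_lt_pow_iff_right (by norm_num : 1 < 2)).1 h₅
    omega
  obtain ⟨c, hc⟩ := hdvd
  have hmod : b ^ (2 ^ s * ordCompl[2] M.totient) ≡ 1 [MOD p ^ k] := by
    rw [hc, pow_mul]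
    simpa using (Nat.ModEq.pow_totient (hb.coprime_dvd_right hpk)).pow c
  exact (Nat.modEq_iff_dvd' (Nat.one_le_pow _ _ (Nat.pos_of_ne_zero fun h => by
    subst h
    have := Nat.eq_one_of_dvd_coprimes hb (dvd_zero _) hpM
    exact hp.ne_one this))).1 hmod.symm

/-- If `a = 2 ^ (s + 3) * M` with `M` odd, coprime to `3` and having only small prime factors, then
`1 + a / 2` is a power of `3` modulo `a`. -/
theorem exists_three_pow_eq {M s : ℕ} (hs0 : s ≠ 0) (hM : Odd M) (h3 : Nat.Coprime 3 M)
    (hs : ∀ p, p.Prime → p ∣ M → p ≤ 2 ^ (s + 1)) :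
    ∃ m t, 3 ^ m = (1 + 2 ^ (s + 2) * M) + 2 ^ (s + 3) * M * t := by
  have hφ : M.totient ≠ 0 := (Nat.totient_pos.2 hM.pos).ne'
  have hc0 : ordCompl[2] M.totient ≠ 0 := (Nat.ordCompl_pos 2 hφ).ne'
  have hdvd := dvd_pow_sub_one_of_prime_le hM h3 hs
  have hc := Nat.not_dvd_ordCompl Nat.prime_two hφ
  set c := ordCompl[2] M.totient
  have hm0 : 2 ^ s * c ≠ 0 := mul_ne_zero (by positivity) hc0
  -- Lifting the exponent: for even `m`, `v₂ (3 ^ m - 1) = v₂ m + 2`.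
  have hval := padicValNat.pow_two_sub_one (x := 3) (n := 2 ^ s * c) (by norm_num) (by norm_num)
    hm0 ((Nat.even_pow.2 ⟨even_two, hs0⟩).mul_right c)
  have h4 : padicValNat 2 (3 + 1) = 2 := by
    rw [show 3 + 1 = 2 ^ 2 by norm_num, padicValNat.prime_pow]
  have h2 : padicValNat 2 (3 - 1) = 1 := by
    rw [show 3 - 1 = 2 ^ 1 by norm_num, padicValNat.prime_pow]
  have hmv : padicValNat 2 (2 ^ s * c) = s := by
    rw [padicValNat.mul (by positivity) hc0, padicValNat.prime_pow,
      padicValNat.eq_zero_of_not_dvd hc, add_zero]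
  rw [h4, h2, hmv] at hval
  have hpow : 3 ^ 1 ≤ 3 ^ (2 ^ s * c) := Nat.pow_le_pow_right (by norm_num) (by omega)
  have hne : 3 ^ (2 ^ s * c) - 1 ≠ 0 := by omega
  have hv : padicValNat 2 (3 ^ (2 ^ s * c) - 1) = s + 2 := by omega
  have h2d : 2 ^ (s + 2) ∣ 3 ^ (2 ^ s * c) - 1 := (padicValNat_dvd_iff_le hne).2 hv.ge
  have h2n : ¬ 2 ^ (s + 3) ∣ 3 ^ (2 ^ s * c) - 1 := fun h => by
    have := (padicValNat_dvd_iff_le hne).1 h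
    omega
  obtain ⟨q, hq⟩ := Nat.Coprime.mul_dvd_of_dvd_of_dvd
    ((Nat.coprime_two_left.2 hM).pow_left (s + 2)) h2d hdvd
  rcases Nat.even_or_odd' q with ⟨t, rfl | rfl⟩
  -- An even cofactor would contribute one power of 2 too many.
  · exact absurd ⟨M * t, by rw [hq]; ring⟩ h2n
  · refine ⟨2 ^ s * c, t, ?_⟩
    have : 3 ^ (2 ^ s * c) = 2 ^ (s + 2) * M * (2 * t + 1) + 1 := by omega
    rw [this]
    ring

/-- The offset 11 is the least possible: `22 ^ 2 < 2 ^ 9`, but `20 ^ 2 > 2 ^ 8`. Hence the threshold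
`n ≥ 21`. -/
theorem two_mul_sq_lt_two_pow (j : ℕ) : (2 * (j + 11)) ^ 2 < 2 ^ (j + 9) := by
  induction j with
  | zero => norm_num
  | succ j ih =>
    calc (2 * (j + 1 + 11)) ^ 2 ≤ 2 * (2 * (j + 11)) ^ 2 := by
          linarith only [Nat.zero_le j, Nat.zero_le (j ^ 2)]
      _ < 2 * 2 ^ (j + 9) := by omega
      _ = 2 ^ (j + 1 + 9) := by ring

theorem one_div_polyProd_not_mem_of_large {n : ℕ} (hn : 21 ≤ n) :
    (1 / (polyProd n : ℝ)) ∉ cantorSet := by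
  obtain ⟨M, hM, h⟩ := exists_odd_polyProd_eq n
  obtain ⟨j, hj⟩ : ∃ j, (n + 1) / 2 = j + 11 := ⟨(n + 1) / 2 - 11, by omega⟩
  rw [hj] at h
  have hMd : M ∣ polyProd n := h ▸ dvd_mul_left _ _
  have h3 : Nat.Coprime 3 M :=
    (Nat.Prime.coprime_iff_not_dvd Nat.prime_three).2 fun h' =>
      three_not_dvd_polyProd n (h'.trans hMd)
  have hs : ∀ p, p.Prime → p ∣ M → p ≤ 2 ^ (j + 8 + 1) := fun p hp hpM => by
    have h₁ := le_of_prime_dvd_polyProd hp (hpM.trans hMd)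
    have h₂ : n ^ 2 ≤ (2 * (j + 11)) ^ 2 := Nat.pow_le_pow_left (by omega) 2
    have h₃ := two_mul_sq_lt_two_pow j
    rw [show j + 8 + 1 = j + 9 by omega]
    omega
  obtain ⟨m, t, hmt⟩ := exists_three_pow_eq (by omega) hM h3 hs
  -- For `r = 1 + a / 2`, the bound `3 * r < 2 * a` means `a > 6`.
  have hbig : 6 < 2 ^ (j + 11) * M := by
    have h₁ : 2 ^ 11 ≤ 2 ^ (j + 11) := Nat.pow_le_pow_right (by norm_num) (by omega)
    have h₂ := hM.pos
    nlinarith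
  have hhalf : 2 ^ (j + 11) * M = 2 * (2 ^ (j + 8 + 2) * M) := by ring
  rw [h]
  refine one_div_not_mem_cantorSet (m := m) (r := 1 + 2 ^ (j + 8 + 2) * M) (t := t) hmt ?_ ?_
  · omega
  · omega

theorem one_div_polyProd_not_mem_of_small {n : ℕ} (h1 : 1 ≤ n) (h2 : n ≠ 2) (hn : n ≤ 20) :
    (1 / (polyProd n : ℝ)) ∉ cantorSet := by
  -- The 80 is only a search bound for the exponent.
  have key : ∀ n ∈ Finset.Icc 1 20, n ≠ 2 → ∃ m ∈ Finset.range 80,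
      polyProd n < 3 * (3 ^ m % polyProd n) ∧ 3 * (3 ^ m % polyProd n) < 2 * polyProd n := by
    decide +kernel
  obtain ⟨m, -, hlo, hhi⟩ := key n (Finset.mem_Icc.2 ⟨h1, hn⟩) h2
  exact one_div_not_mem_cantorSet (Nat.mod_add_div _ _).symm hlo hhi

theorem one_div_polyProd_mem_cantorSet_iff {n : ℕ} (hn : 1 ≤ n) :
    1 / (polyProd n : ℝ) ∈ cantorSet ↔ n = 2 := by
  constructor
  · intro h
    by_contra h2
    rcases le_or_gt n 20 with h' | h'
    · exact one_div_polyProd_not_mem_of_small hn h2 h' h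
    · exact one_div_polyProd_not_mem_of_large h' h
  · rintro rfl
    have : polyProd 2 = 10 := by decide
    rw [this]
    exact_mod_cast one_tenth_mem_cantorSet

theorem mainTheorem10 :
    ({x : ℝ | ∃ n : ℕ, 1 ≤ n ∧ x = 1 / (polyProd n : ℝ)} ∩ missingDigitSet 3 {0, 2}
        = {(1 / 10 : ℝ)}) ∧
      ∀ n : ℕ, 1 ≤ n → (1 / (polyProd n : ℝ) ∈ missingDigitSet 3 {0, 2} ↔ n = 2) := by
  rw [missingDigitSet_three_eq_cantorSet]
  have h10 : (1 / (polyProd 2 : ℝ)) = 1 / 10 := by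
    have : polyProd 2 = 10 := by decide
    rw [this]
    norm_num
  refine ⟨?_, fun n hn => one_div_polyProd_mem_cantorSet_iff hn⟩
  ext x
  constructor
  · rintro ⟨⟨n, hn, rfl⟩, hx⟩
    rw [(one_div_polyProd_mem_cantorSet_iff hn).1 hx]
    exact h10
  · rintro rfl
    exact ⟨⟨2, by norm_num, h10.symm⟩, one_tenth_mem_cantorSet⟩
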